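/- **One Radius Theorem.** Let $k\ge 1$ be an integer, $\rho>0$ and $\kappa=-1/\rho^2$. Consider the ball model $\{m\in\mathbb{R}^{k+1}: |m|<\rho\}$, with metric $\frac{2\rho^2}{\rho^2-|m|^2}|dm|$, of the $(k+1)$-dimensional hyperbolic space of constant sectional curvature $\kappa$, and let $r=\rho\ln\frac{\rho+|m|}{\rho-|m|}$ be the hyperbolic distance from the origin. A radial eigenfunction with eigenvalue $\lambda\in\mathbb{C}$ is a function $\varphi:[0,\infty)\to\mathbb{C}$ of $r$ with $\triangle\varphi+\lambda\varphi=0$, where $\triangle$ is the hyperbolic Laplacian; on functions of $r$ it is $$\triangle\varphi(r)=\varphi''(r)+\frac{k}{\rho}\coth\left(\frac{r}{\rho}\right)\varphi'(r).$$ This may be understood either as: $m\mapsto\varphi(r(m))$ is $C^2$ on the ball and satisfies the eigenvalue equation for the Laplace–Beltrami operator there; or as: $\varphi$ is continuous at $0$, twice differentiable on $(0,\infty)$ and satisfies $\varphi''+\frac{k}{\rho}\coth(\frac r\rho)\varphi'+\lambda\varphi=0$ for all $r>0$. Let $\mu\ne\nu$ be complex numbers and let $\varphi_\mu,\varphi_\nu$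 be radial eigenfunctions with eigenvalues $\mu$ and $\nu$ and with $\varphi_\mu(0)=\varphi_\nu(0)=1$. Let $\alpha,\beta\in\mathbb{C}$ be any numbers with $$\mu=-\kappa(\alpha k-\alpha^2),\qquad \nu=-\kappa(\beta k-\beta^2),$$ and let $p=\max\{|\mathrm{Im}\,\alpha|,|\mathrm{Im}\,\beta|\}$. Then $\varphi_\mu(r)\ne\varphi_\nu(r)$ for every $r\in(0,\pi\rho/(2p)]$, where this interval is read as $(0,\infty)$ if $p=0$. In particular, if $\mu$ and $\nu$ are real and $\mu,\nu\le-\kappa k^2/4$, then $\varphi_\mu(r)\ne\varphi_\nu(r)$ for every $r>0$. -/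

import Mathlib

noncomputable section

/-- Conformal factor `2ρ²/(ρ² - |m|²)` of the ball model `{|m| < ρ} ⊆ ℝ^(k+1)` of hyperbolic
space of curvature `-1/ρ²`: the metric is `g = (conformalFactor)² |dm|²`. -/
def conformalFactor {k : ℕ} (ρ : ℝ) (m : EuclideanSpace ℝ (Fin (k + 1))) : ℝ :=
  2 * ρ ^ 2 / (ρ ^ 2 - ‖m‖ ^ 2)

/-- Partial derivative in the `i`-th Euclidean coordinate. -/
def partialDeriv {k : ℕ} (i : Fin (k + 1)) (f : EuclideanSpace ℝ (Fin (k + 1)) → ℂ)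
    (m : EuclideanSpace ℝ (Fin (k + 1))) : ℂ :=
  fderiv ℝ f m (EuclideanSpace.single i 1)

/-- The Laplace–Beltrami operator `(det g)^(-1/2) ∑ᵢ ∂ᵢ ((det g)^(1/2) gⁱⁱ ∂ᵢ f)` of the ball model
of dimension `k + 1`; with `c` the conformal factor, `(det g)^(1/2) = c^(k+1)`, `gⁱⁱ = c⁻²`. -/
def hyperbolicLaplacian {k : ℕ} (ρ : ℝ) (f : EuclideanSpace ℝ (Fin (k + 1)) → ℂ)
    (m : EuclideanSpace ℝ (Fin (k + 1))) : ℂ :=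
  (((conformalFactor ρ m ^ (k + 1))⁻¹ : ℝ) : ℂ) *
    ∑ i : Fin (k + 1), partialDeriv i
      (fun x => ((conformalFactor ρ x ^ (k + 1) * (conformalFactor ρ x ^ 2)⁻¹ : ℝ) : ℂ)
        * partialDeriv i f x) m

/-- Hyperbolic distance from the origin in the ball model. -/
def hyperbolicRadius {k : ℕ} (ρ : ℝ) (m : EuclideanSpace ℝ (Fin (k + 1))) : ℝ :=
  ρ * Real.log ((ρ + ‖m‖) / (ρ - ‖m‖))

/-- `φ`, as a function of the hyperbolic distance `r` from the origin, is a radial eigenfunction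
of the Laplacian of the ball model: `Δ f + μ f = 0` for `f m = φ (r m)`. -/
structure IsRadialEigenfunction (k : ℕ) (ρ : ℝ) (μ : ℂ) (φ : ℝ → ℂ) : Prop where
  contDiffOn : ContDiffOn ℝ 2
    (fun m : EuclideanSpace ℝ (Fin (k + 1)) => φ (hyperbolicRadius ρ m)) (Metric.ball 0 ρ)
  eigen : ∀ m ∈ Metric.ball (0 : EuclideanSpace ℝ (Fin (k + 1))) ρ,
    hyperbolicLaplacian ρ (fun x => φ (hyperbolicRadius ρ x)) m + μ * φ (hyperbolicRadius ρ m) = 0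

/-- The hyperbolic Laplacian on radial functions in geodesic polar coordinates:
`φ'' + (k/ρ) coth(r/ρ) φ'`. -/
def polarLaplacian (k : ℕ) (ρ : ℝ) (φ : ℝ → ℂ) (r : ℝ) : ℂ :=
  deriv (deriv φ) r +
    ((k / ρ * (Real.cosh (r / ρ) / Real.sinh (r / ρ)) : ℝ) : ℂ) * deriv φ r

/-- `φ : [0, ∞) → ℂ` is a radial eigenfunction in geodesic polar coordinates. The coefficient
`coth (r/ρ)` is singular at `r = 0`; there only continuity is required. -/
structure IsPolarEigenfunction (k : ℕ) (ρ : ℝ) (μ : ℂ) (φ : ℝ → ℂ) : Prop where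
  continuousWithinAt_zero : ContinuousWithinAt φ (Set.Ici 0) 0
  differentiableOn : DifferentiableOn ℝ φ (Set.Ioi 0)
  differentiableOn_deriv : DifferentiableOn ℝ (deriv φ) (Set.Ioi 0)
  eigen : ∀ r : ℝ, 0 < r → polarLaplacian k ρ φ r + μ * φ r = 0

/-- The interval `(0, πρ/(2p)]`, read as `(0, ∞)` when `p = 0`. -/
def oneRadiusInterval (ρ p : ℝ) : Set ℝ :=
  if p = 0 then Set.Ioi 0 else Set.Ioc 0 (Real.pi * ρ / (2 * p))

end

/-!
In curvature `-1` the eigenfunction with eigenvalue `α (k - α)` is, up to a constant, the mean over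
spheres of the horospherical wave `exp (-α B)`, `B` being a Busemann function: the eikonal equation
makes the wave an eigenfunction, and bounded solutions of the radial equation are unique up to
scaling. The exponents `α` and `k - α` have the same eigenvalue, hence the same mean, so the wave
may be replaced by `exp (-k B / 2) cosh ((α - k / 2) B)`. The difference of two such means has the
integrand

  `2 exp (-k B / 2) sinh ((α + β - k) / 2 * B) sinh ((α - β) / 2 * B)`.

On the sphere of radius `r` one has `|B| ≤ r`. As long as `(|Im α| + |Im β|) r ≤ π`, each `sinh`
stays in the quadrant of its coefficient, so the integrand stays in a fixed half-plane and its
integral cannot vanish.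
-/

open Filter Topology

/-! ### Uniqueness for the radial equation -/

theorem exists_mem_Ioo_deriv_mul_eq {f : ℝ → ℝ} (hf : DifferentiableOn ℝ f (Set.Ioi 0)) {r : ℝ}
    (hr : 0 < r) : ∃ s ∈ Set.Ioo r (2 * r), deriv f s * r = f (2 * r) - f r := by
  have hsub : Set.Icc r (2 * r) ⊆ Set.Ioi 0 := fun s hs => hr.trans_le hs.1
  obtain ⟨s, hs, hderiv⟩ := exists_deriv_eq_slope f (show r < 2 * r by linarith)
    (hf.continuousOn.mono hsub) (hf.mono (Set.Ioo_subset_Icc_self.trans hsub))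
  refine ⟨s, hs, ?_⟩
  rw [hderiv, show 2 * r - r = r by ring, div_mul_cancel₀ _ hr.ne']

theorem eq_zero_of_tendsto_mul_deriv_real {f w : ℝ → ℝ} {l c : ℝ}
    (hf : DifferentiableOn ℝ f (Set.Ioi 0)) (hl : Tendsto f (𝓝[>] 0) (𝓝 l))
    (hw : w =O[𝓝[>] 0] id) (hc : Tendsto (fun r => w r * deriv f r) (𝓝[>] 0) (𝓝 c)) : c = 0 := by
  obtain ⟨C, hC, hwC⟩ := hw.exists_pos
  choose! s hs hderiv using fun r (hr : 0 < r) => exists_mem_Ioo_deriv_mul_eq hf hr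
  have tendsto_two_mul : Tendsto (fun r : ℝ => 2 * r) (𝓝[>] 0) (𝓝[>] 0) := by
    refine tendsto_nhdsWithin_iff.2 ⟨?_, ?_⟩
    · exact (Continuous.tendsto' (by fun_prop) _ _ (by simp)).mono_left nhdsWithin_le_nhds
    · filter_upwards [self_mem_nhdsWithin] with r (hr : 0 < r) using mul_pos two_pos hr
  have tendsto_s : Tendsto s (𝓝[>] 0) (𝓝[>] 0) := by
    refine tendsto_nhdsWithin_iff.2 ⟨tendsto_of_tendsto_of_tendsto_of_le_of_le'
      tendsto_const_nhds (tendsto_nhds_of_tendsto_nhdsWithin tendsto_two_mul) ?_ ?_, ?_⟩ <;>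
      filter_upwards [self_mem_nhdsWithin] with r (hr : 0 < r)
    exacts [(hr.trans (hs r hr).1).le, (hs r hr).2.le, hr.trans (hs r hr).1]
  have tendsto_diff : Tendsto (fun r => 2 * C * |f (2 * r) - f r|) (𝓝[>] 0) (𝓝 0) := by
    simpa using ((hl.comp tendsto_two_mul).sub hl).abs.const_mul (2 * C)
  refine tendsto_nhds_unique (hc.comp tendsto_s) (squeeze_zero_norm' ?_ tendsto_diff)
  filter_upwards [self_mem_nhdsWithin, tendsto_s.eventually hwC.bound] with r (hr : 0 < r) hwr
  rw [id, Real.norm_of_nonneg (hr.trans (hs r hr).1).le] at hwr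
  calc ‖w (s r) * deriv f (s r)‖ = ‖w (s r)‖ * |deriv f (s r)| := norm_mul _ _
    _ ≤ C * (2 * r) * |deriv f (s r)| := by
        gcongr
        exact hwr.trans (mul_le_mul_of_nonneg_left (hs r hr).2.le hC.le)
    _ = 2 * C * |f (2 * r) - f r| := by
        rw [← hderiv r hr, abs_mul, abs_of_pos hr]
        ring

/-- A solution that is bounded near the singular point `0` carries no flux out of it. -/
theorem eq_zero_of_tendsto_mul_deriv {f : ℝ → ℂ} {w : ℝ → ℝ} {l c : ℂ}
    (hf : DifferentiableOn ℝ f (Set.Ioi 0)) (hl : Tendsto f (𝓝[>] 0) (𝓝 l))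
    (hw : w =O[𝓝[>] 0] id) (hc : Tendsto (fun r => w r * deriv f r) (𝓝[>] 0) (𝓝 c)) : c = 0 := by
  have map_eq_zero (L : ℂ →L[ℝ] ℝ) : L c = 0 := by
    refine eq_zero_of_tendsto_mul_deriv_real (f := fun r => L (f r)) (l := L l)
      (L.differentiable.comp_differentiableOn hf) ((L.continuous.tendsto l).comp hl) hw ?_
    refine ((L.continuous.tendsto c).comp hc).congr' ?_
    filter_upwards [self_mem_nhdsWithin] with r hr
    have hfr := ((hf r hr).differentiableAt (Ioi_mem_nhds hr)).hasDerivAt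
    have hLfr : HasDerivAt (fun r => L (f r)) (L (deriv f r)) r :=
      L.hasFDerivAt.comp_hasDerivAt r hfr
    rw [hLfr.deriv, Function.comp_apply, ← Complex.real_smul, map_smul, smul_eq_mul]
  exact Complex.ext (map_eq_zero Complex.reCLM) (map_eq_zero Complex.imCLM)

theorem sinh_div_pow_isBigO {k : ℕ} (hk : k ≠ 0) (ρ : ℝ) :
    (fun r => Real.sinh (r / ρ) ^ k) =O[𝓝[>] 0] id := by
  have hdiff : DifferentiableAt ℝ (fun r => Real.sinh (r / ρ) ^ k) 0 := by fun_prop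
  simpa [hk, Function.id_def] using hdiff.isBigO_sub.mono nhdsWithin_le_nhds

theorem hasDerivAt_sinh_div_pow (k : ℕ) {ρ r : ℝ} (hρ : 0 < ρ) (hr : 0 < r) :
    HasDerivAt (fun r => Real.sinh (r / ρ) ^ k)
      (Real.sinh (r / ρ) ^ k * (k / ρ * (Real.cosh (r / ρ) / Real.sinh (r / ρ)))) r := by
  have hsinh : Real.sinh (r / ρ) ≠ 0 := (Real.sinh_pos_iff.2 (div_pos hr hρ)).ne'
  refine (((hasDerivAt_id r).div_const ρ).sinh.pow k).congr_deriv ?_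
  rcases k with - | k
  · simp
  · simp only [Nat.add_sub_cancel, id, pow_succ]
    field_simp

theorem hasDerivAt_mul_pow_succ_div_factorial (M a : ℝ) (n : ℕ) (r : ℝ) :
    HasDerivAt (fun r => M * ((a * r) ^ (n + 1) / (n + 1).factorial))
      (a * (M * ((a * r) ^ n / n.factorial))) r := by
  refine (((((hasDerivAt_id r).const_mul a).pow (n + 1)).div_const
    ((n + 1).factorial : ℝ)).const_mul M).congr_deriv ?_
  have hfact := Nat.cast_ne_zero (R := ℝ).2 n.factorial_ne_zero
  rw [Nat.factorial_succ]
  push_cast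
  field_simp
  simp

namespace IsPolarEigenfunction

variable {k : ℕ} {ρ : ℝ} {μ : ℂ} {φ ψ : ℝ → ℂ}

theorem hasDerivAt (h : IsPolarEigenfunction k ρ μ φ) {r : ℝ} (hr : 0 < r) :
    HasDerivAt φ (deriv φ r) r :=
  ((h.differentiableOn r hr).differentiableAt (Ioi_mem_nhds hr)).hasDerivAt

theorem hasDerivAt_deriv (h : IsPolarEigenfunction k ρ μ φ) {r : ℝ} (hr : 0 < r) :
    HasDerivAt (deriv φ)
      (-((k / ρ * (Real.cosh (r / ρ) / Real.sinh (r / ρ)) : ℝ) * deriv φ r + μ * φ r)) r := by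
  refine ((h.differentiableOn_deriv r hr).differentiableAt
    (Ioi_mem_nhds hr)).hasDerivAt.congr_deriv ?_
  have heigen := h.eigen r hr
  rw [polarLaplacian] at heigen
  linear_combination heigen

theorem tendsto_zero (h : IsPolarEigenfunction k ρ μ φ) : Tendsto φ (𝓝[>] 0) (𝓝 (φ 0)) :=
  h.continuousWithinAt_zero.mono Set.Ioi_subset_Ici_self

theorem continuousOn (h : IsPolarEigenfunction k ρ μ φ) : ContinuousOn φ (Set.Ici 0) := by
  intro r hr
  rcases (Set.mem_Ici.1 hr).eq_or_lt with rfl | hr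
  · exact h.continuousWithinAt_zero
  · exact (h.hasDerivAt hr).continuousAt.continuousWithinAt

theorem hasDerivAt_flux (h : IsPolarEigenfunction k ρ μ φ) (hρ : 0 < ρ) {r : ℝ} (hr : 0 < r) :
    HasDerivAt (fun r => ((Real.sinh (r / ρ) ^ k : ℝ) : ℂ) * deriv φ r)
      (-μ * (((Real.sinh (r / ρ) ^ k : ℝ) : ℂ) * φ r)) r := by
  refine ((hasDerivAt_sinh_div_pow k hρ hr).ofReal_comp.mul (h.hasDerivAt_deriv hr)).congr_deriv ?_
  rw [Complex.ofReal_mul]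
  ring

theorem sinh_pow_mul_deriv_eq_integral (h : IsPolarEigenfunction k ρ μ φ) (hk : k ≠ 0)
    (hρ : 0 < ρ) {r : ℝ} (hr : 0 < r) :
    ((Real.sinh (r / ρ) ^ k : ℝ) : ℂ) * deriv φ r =
      ∫ s in (0 : ℝ)..r, -μ * (((Real.sinh (s / ρ) ^ k : ℝ) : ℂ) * φ s) := by
  set flux : ℝ → ℂ := fun s => ((Real.sinh (s / ρ) ^ k : ℝ) : ℂ) * deriv φ s
  set flux' : ℝ → ℂ := fun s => -μ * (((Real.sinh (s / ρ) ^ k : ℝ) : ℂ) * φ s)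
  have hcont : ContinuousOn flux' (Set.Ici 0) :=
    continuousOn_const.mul ((Continuous.continuousOn (by fun_prop)).mul h.continuousOn)
  have hint {s : ℝ} (hs : 0 ≤ s) : IntervalIntegrable flux' MeasureTheory.volume r s :=
    (hcont.mono fun x hx => (le_min hr.le hs).trans hx.1).intervalIntegrable
  have flux_eq : ∀ s : ℝ, 0 < s → flux r + ∫ x in r..s, flux' x = flux s := fun s hs => by
    rw [intervalIntegral.integral_eq_sub_of_hasDerivAt (f := flux)
      (fun x hx => h.hasDerivAt_flux hρ ((lt_min hr hs).trans_le hx.1)) (hint hs.le)]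
    ring
  have hprimitive : Tendsto (fun s => ∫ x in r..s, flux' x) (𝓝[>] 0)
      (𝓝 (∫ x in r..0, flux' x)) :=
    ((intervalIntegral.continuousOn_primitive_interval' (hint le_rfl) Set.left_mem_uIcc 0
      Set.right_mem_uIcc).mono_left (nhdsWithin_le_of_mem (by
        filter_upwards [Ioc_mem_nhdsGT hr] with s hs using Set.mem_uIcc_of_ge hs.1.le hs.2)))
  have hflux : Tendsto flux (𝓝[>] 0) (𝓝 (flux r + ∫ x in r..0, flux' x)) :=
    (tendsto_const_nhds.add hprimitive).congr' (by
      filter_upwards [self_mem_nhdsWithin] with s hs using flux_eq s hs)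
  have hzero := eq_zero_of_tendsto_mul_deriv h.differentiableOn h.tendsto_zero
    (sinh_div_pow_isBigO hk ρ) hflux
  rwa [intervalIntegral.integral_symm, ← sub_eq_add_neg, sub_eq_zero] at hzero

theorem norm_deriv_le (h : IsPolarEigenfunction k ρ μ φ) (hk : k ≠ 0) (hρ : 0 < ρ) {r b : ℝ}
    (hr : 0 < r) (hb : ∀ s ∈ Set.Ioc 0 r, ‖φ s‖ ≤ b) : ‖deriv φ r‖ ≤ ‖μ‖ * r * b := by
  have hS : 0 < Real.sinh (r / ρ) ^ k := pow_pos (Real.sinh_pos_iff.2 (div_pos hr hρ)) k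
  have hbound : ∀ s ∈ Set.uIoc 0 r, ‖-μ * (((Real.sinh (s / ρ) ^ k : ℝ) : ℂ) * φ s)‖ ≤
      ‖μ‖ * (Real.sinh (r / ρ) ^ k * b) := fun s hs => by
    rw [Set.uIoc_of_le hr.le] at hs
    have hs0 : 0 ≤ Real.sinh (s / ρ) := Real.sinh_nonneg_iff.2 (div_nonneg hs.1.le hρ.le)
    have hsr : Real.sinh (s / ρ) ≤ Real.sinh (r / ρ) :=
      Real.sinh_le_sinh.2 (div_le_div_of_nonneg_right hs.2 hρ.le)
    rw [norm_mul, norm_mul, norm_neg, Complex.norm_of_nonneg (pow_nonneg hs0 k)]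
    gcongr
    exact hb s hs
  have hle := intervalIntegral.norm_integral_le_of_norm_le_const hbound
  rw [← h.sinh_pow_mul_deriv_eq_integral hk hρ hr, norm_mul, Complex.norm_of_nonneg hS.le,
    sub_zero, abs_of_pos hr] at hle
  refine le_of_mul_le_mul_left (hle.trans_eq ?_) hS
  ring

theorem hasDerivWithinAt_zero (h : IsPolarEigenfunction k ρ μ φ) (hk : k ≠ 0) (hρ : 0 < ρ) :
    HasDerivWithinAt φ 0 (Set.Ici 0) 0 := by
  obtain ⟨M, hM⟩ := (isCompact_Icc (a := (0 : ℝ)) (b := 1)).exists_bound_of_continuousOn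
    (h.continuousOn.mono Set.Icc_subset_Ici_self)
  refine hasDerivWithinAt_Ici_of_tendsto_deriv h.differentiableOn
    (h.continuousWithinAt_zero.mono Set.Ioi_subset_Ici_self) self_mem_nhdsWithin ?_
  have hlim : Tendsto (fun r => ‖μ‖ * r * M) (𝓝[>] 0) (𝓝 0) :=
    (Continuous.tendsto' (by fun_prop) _ _ (by simp)).mono_left nhdsWithin_le_nhds
  refine squeeze_zero_norm' ?_ hlim
  filter_upwards [Ioc_mem_nhdsGT one_pos] with r hr
  exact h.norm_deriv_le hk hρ hr.1 fun s hs => hM s ⟨hs.1.le, hs.2.trans hr.2⟩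

theorem norm_le_mul_pow_div_factorial (h : IsPolarEigenfunction k ρ μ φ) (hk : k ≠ 0)
    (hρ : 0 < ρ) (h0 : φ 0 = 0) {R M : ℝ} (hM : ∀ s ∈ Set.Icc 0 R, ‖φ s‖ ≤ M) (n : ℕ) :
    ∀ r ∈ Set.Icc 0 R, ‖φ r‖ ≤ M * ((‖μ‖ * R * r) ^ n / n.factorial) := by
  induction n with
  | zero => simpa using hM
  | succ n ih =>
    have hφ' : ∀ r ∈ Set.Ico 0 R, HasDerivWithinAt φ (if r = 0 then 0 else deriv φ r)
        (Set.Ici r) r := fun r hr => by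
      split_ifs with hr0
      · exact hr0 ▸ h.hasDerivWithinAt_zero hk hρ
      · exact (h.hasDerivAt (lt_of_le_of_ne hr.1 (Ne.symm hr0))).hasDerivWithinAt
    refine image_norm_le_of_norm_deriv_right_le_deriv_boundary
      (h.continuousOn.mono Set.Icc_subset_Ici_self) hφ' (by simp [h0])
      (hasDerivAt_mul_pow_succ_div_factorial M (‖μ‖ * R) n) fun r hr => ?_
    have hR : 0 ≤ R := hr.1.trans hr.2.le
    have hM0 : 0 ≤ M := (norm_nonneg _).trans (hM 0 ⟨le_rfl, hR⟩)
    split_ifs with hr0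
    · rw [norm_zero, hr0]
      positivity
    have hrpos : 0 < r := lt_of_le_of_ne hr.1 (Ne.symm hr0)
    refine (h.norm_deriv_le hk hρ hrpos (b := M * ((‖μ‖ * R * r) ^ n / n.factorial)) ?_).trans ?_
    · refine fun s hs => (ih s ⟨hs.1.le, hs.2.trans hr.2.le⟩).trans ?_
      have hs0 := hs.1.le
      gcongr
      exact hs.2
    · gcongr
      exact hr.2.le

theorem eq_zero (h : IsPolarEigenfunction k ρ μ φ) (hk : k ≠ 0) (hρ : 0 < ρ) (h0 : φ 0 = 0)
    {r : ℝ} (hr : 0 ≤ r) : φ r = 0 := by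
  obtain ⟨M, hM⟩ := (isCompact_Icc (a := 0) (b := r)).exists_bound_of_continuousOn
    (h.continuousOn.mono Set.Icc_subset_Ici_self)
  have hlim : Tendsto (fun n : ℕ => M * ((‖μ‖ * r * r) ^ n / n.factorial)) atTop (𝓝 0) := by
    simpa using (FloorSemiring.tendsto_pow_div_factorial_atTop (‖μ‖ * r * r)).const_mul M
  exact norm_le_zero_iff.1 (ge_of_tendsto' hlim fun n =>
    h.norm_le_mul_pow_div_factorial hk hρ h0 hM n r ⟨hr, le_rfl⟩)

theorem of_hasDerivAt {φ' φ'' : ℝ → ℂ} (hcont : ContinuousWithinAt φ (Set.Ici 0) 0)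
    (hφ : ∀ r, 0 < r → HasDerivAt φ (φ' r) r) (hφ' : ∀ r, 0 < r → HasDerivAt φ' (φ'' r) r)
    (heigen : ∀ r, 0 < r → φ'' r +
      ((k / ρ * (Real.cosh (r / ρ) / Real.sinh (r / ρ)) : ℝ) : ℂ) * φ' r + μ * φ r = 0) :
    IsPolarEigenfunction k ρ μ φ := by
  have hderiv : ∀ r, 0 < r → HasDerivAt (deriv φ) (φ'' r) r := fun r hr =>
    (hφ' r hr).congr_of_eventuallyEq (by
      filter_upwards [Ioi_mem_nhds hr] with s hs using (hφ s hs).deriv)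
  refine ⟨hcont, fun r hr => (hφ r hr).differentiableAt.differentiableWithinAt,
    fun r hr => (hderiv r hr).differentiableAt.differentiableWithinAt, fun r hr => ?_⟩
  rw [polarLaplacian, (hderiv r hr).deriv, (hφ r hr).deriv]
  exact heigen r hr

theorem const_mul_sub_const_mul (hφ : IsPolarEigenfunction k ρ μ φ)
    (hψ : IsPolarEigenfunction k ρ μ ψ) (a b : ℂ) :
    IsPolarEigenfunction k ρ μ (fun r => a * φ r - b * ψ r) :=
  .of_hasDerivAt ((hφ.continuousWithinAt_zero.const_mul a).sub
      (hψ.continuousWithinAt_zero.const_mul b))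
    (fun _ hr => ((hφ.hasDerivAt hr).const_mul a).sub ((hψ.hasDerivAt hr).const_mul b))
    (fun _ hr => ((hφ.hasDerivAt_deriv hr).const_mul a).sub
      ((hψ.hasDerivAt_deriv hr).const_mul b))
    (fun _ _ => by ring)

theorem mul_eq_mul (hφ : IsPolarEigenfunction k ρ μ φ) (hψ : IsPolarEigenfunction k ρ μ ψ)
    (hk : k ≠ 0) (hρ : 0 < ρ) {r : ℝ} (hr : 0 ≤ r) : ψ 0 * φ r = φ 0 * ψ r :=
  sub_eq_zero.1 ((hφ.const_mul_sub_const_mul hψ (ψ 0) (φ 0)).eq_zero hk hρ (by ring) hr)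

theorem comp_mul_left (h : IsPolarEigenfunction k ρ μ φ) {c : ℝ} (hc : 0 < c) :
    IsPolarEigenfunction k (ρ / c) (c ^ 2 * μ) (fun t => φ (c * t)) := by
  have hlin (t : ℝ) : HasDerivAt (fun t => c * t) c t := by
    simpa using (hasDerivAt_id t).const_mul c
  refine .of_hasDerivAt ?_
    (fun t ht => (h.hasDerivAt (mul_pos hc ht)).scomp t (hlin t))
    (fun t ht => ((h.hasDerivAt_deriv (mul_pos hc ht)).scomp t (hlin t)).const_smul c)
    (fun t _ => ?_)
  · refine ContinuousWithinAt.comp (t := Set.Ici 0) (by simpa using h.continuousWithinAt_zero)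
      (hlin 0).continuousAt.continuousWithinAt fun t ht => mul_nonneg hc.le ht
  · have hdiv : t / (ρ / c) = c * t / ρ := by rw [div_div_eq_mul_div, mul_comm]
    rw [hdiv]
    simp only [Complex.real_smul, div_div_eq_mul_div, Complex.ofReal_mul,
      Complex.ofReal_div]
    ring

end IsPolarEigenfunction

/-! ### Products of hyperbolic sines in a half-plane -/

theorem exists_pos_sinh_mul_eq_mul (x : ℝ) {s : ℝ} (hs : 0 < s) :
    ∃ a : ℝ, 0 < a ∧ Real.sinh (x * s) = a * x := by
  rcases eq_or_ne x 0 with rfl | hx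
  · exact ⟨1, one_pos, by simp⟩
  refine ⟨Real.sinh (x * s) / x, ?_, (div_mul_cancel₀ _ hx).symm⟩
  rcases hx.lt_or_gt with hx | hx
  · exact div_pos_of_neg_of_neg (Real.sinh_neg_iff.2 (mul_neg_of_neg_of_pos hx hs)) hx
  · exact div_pos (Real.sinh_pos_iff.2 (mul_pos hx hs)) hx

theorem exists_pos_sin_mul_eq_mul {y s : ℝ} (hs : 0 < s) (hys : |y| * s < Real.pi) :
    ∃ b : ℝ, 0 < b ∧ Real.sin (y * s) = b * y := by
  rcases eq_or_ne y 0 with rfl | hy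
  · exact ⟨1, one_pos, by simp⟩
  refine ⟨Real.sin (y * s) / y, ?_, (div_mul_cancel₀ _ hy).symm⟩
  rcases hy.lt_or_gt with hy | hy
  · rw [abs_of_neg hy] at hys
    exact div_pos_of_neg_of_neg
      (Real.sin_neg_of_neg_of_neg_pi_lt (mul_neg_of_neg_of_pos hy hs) (by linarith)) hy
  · rw [abs_of_pos hy] at hys
    exact div_pos (Real.sin_pos_of_pos_of_lt_pi (mul_pos hy hs) hys) hy

theorem sinh_mul_ofReal (z : ℂ) (s : ℝ) :
    Complex.sinh (z * s) = ⟨Real.sinh (z.re * s) * Real.cos (z.im * s),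
      Real.cosh (z.re * s) * Real.sin (z.im * s)⟩ := by
  have hzs : z * s = ((z.re * s : ℝ) : ℂ) + ((z.im * s : ℝ) : ℂ) * Complex.I := by
    apply Complex.ext <;> simp
  rw [hzs, Complex.sinh_add, Complex.cosh_mul_I, Complex.sinh_mul_I]
  apply Complex.ext <;>
    simp [← Complex.ofReal_sinh, ← Complex.ofReal_cosh, ← Complex.ofReal_sin,
      ← Complex.ofReal_cos, -Complex.ofReal_mul]

theorem exists_pos_sinh_mul_ofReal_eq {z : ℂ} {s : ℝ} (hs : 0 < s)
    (hzs : |z.im| * s < Real.pi / 2) :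
    ∃ a b : ℝ, 0 < a ∧ 0 < b ∧ Complex.sinh (z * s) = ⟨a * z.re, b * z.im⟩ := by
  obtain ⟨a, ha, hsinh⟩ := exists_pos_sinh_mul_eq_mul z.re hs
  obtain ⟨b, hb, hsin⟩ := exists_pos_sin_mul_eq_mul (y := z.im) hs
    (hzs.trans (half_lt_self Real.pi_pos))
  have hcos : 0 < Real.cos (z.im * s) := by
    refine Real.cos_pos_of_mem_Ioo (abs_lt.1 ?_)
    rwa [abs_mul, abs_of_pos hs]
  refine ⟨a * Real.cos (z.im * s), Real.cosh (z.re * s) * b, mul_pos ha hcos,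
    mul_pos (Real.cosh_pos _) hb, ?_⟩
  rw [sinh_mul_ofReal, hsinh, hsin]
  congr 1 <;> ring

theorem sub_mul_sub_pos_of_mul_nonpos {p q x y : ℝ} (hp : 0 < p) (hq : 0 < q) (hxy : x * y ≤ 0)
    (hne : x ≠ 0 ∨ y ≠ 0) : 0 < (x - y) * (p * x - q * y) := by
  have hsq : 0 < p * x ^ 2 + q * y ^ 2 := by rcases hne with h | h <;> positivity
  calc 0 < p * x ^ 2 + q * y ^ 2 + (p + q) * -(x * y) :=
        add_pos_of_pos_of_nonneg hsq (mul_nonneg (by positivity) (neg_nonneg.2 hxy))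
    _ = (x - y) * (p * x - q * y) := by ring

/-- Scaling the coordinates of `z` and of `w` by positive factors keeps each of them in its
quadrant, which confines their product to an open half-plane. -/
theorem exists_forall_re_mul_pos {z w : ℂ} (hz : z ≠ 0) (hw : w ≠ 0) :
    ∃ u : ℂ, ∀ a b c d : ℝ, 0 < a → 0 < b → 0 < c → 0 < d →
      0 < (u * ((⟨a * z.re, b * z.im⟩ : ℂ) * ⟨c * w.re, d * w.im⟩)).re := by
  by_cases h : z.re * w.re * (z.im * w.im) ≤ 0 ∧ (z.re * w.re ≠ 0 ∨ z.im * w.im ≠ 0)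
  · refine ⟨⟨z.re * w.re - z.im * w.im, 0⟩, fun a b c d ha hb hc hd => ?_⟩
    refine (sub_mul_sub_pos_of_mul_nonpos (mul_pos ha hc) (mul_pos hb hd) h.1 h.2).trans_eq ?_
    simp only [Complex.mul_re, Complex.mul_im]
    ring
  · have hnonneg : 0 ≤ z.re * w.re * (z.im * w.im) := by
      by_contra! hneg
      exact h ⟨hneg.le, .inl (left_ne_zero_of_mul hneg.ne)⟩
    have hmul : z.re * w.im * -(z.im * w.re) ≤ 0 := by linarith
    have hne : z.re * w.im ≠ 0 ∨ -(z.im * w.re) ≠ 0 := by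
      by_contra! hzero
      have hle : z.re * w.re * (z.im * w.im) ≤ 0 :=
        le_of_eq (by linear_combination z.im * w.re * hzero.1)
      have hzero' : z.re * w.re = 0 ∧ z.im * w.im = 0 :=
        by_contra fun hne => h ⟨hle, not_and_or.1 hne⟩
      refine mul_ne_zero hz hw (Complex.ext ?_ ?_)
      · rw [Complex.mul_re, Complex.zero_re]
        linear_combination hzero'.1 - hzero'.2
      · rw [Complex.mul_im, Complex.zero_im]
        linear_combination hzero.1 - hzero.2
    refine ⟨⟨0, -(z.re * w.im + z.im * w.re)⟩, fun a b c d ha hb hc hd => ?_⟩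
    refine (sub_mul_sub_pos_of_mul_nonpos (mul_pos ha hd) (mul_pos hb hc) hmul hne).trans_eq ?_
    simp only [Complex.mul_re, Complex.mul_im]
    ring

theorem exists_forall_re_mul_sinh_mul_sinh_pos {z w : ℂ} (hz : z ≠ 0) (hw : w ≠ 0) {t : ℝ}
    (hzt : |z.im| * t ≤ Real.pi / 2) (hwt : |w.im| * t ≤ Real.pi / 2) :
    ∃ u : ℂ, ∀ s : ℝ, s ≠ 0 → |s| < t →
      0 < (u * (Complex.sinh (z * s) * Complex.sinh (w * s))).re := by
  obtain ⟨u, hu⟩ := exists_forall_re_mul_pos hz hw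
  have lt_pi_div_two {x s : ℝ} (hst : s < t) (hxt : |x| * t ≤ Real.pi / 2) :
      |x| * s < Real.pi / 2 := by
    rcases (abs_nonneg x).eq_or_lt with hx | hx
    · simp [← hx, Real.pi_pos]
    · exact (mul_lt_mul_of_pos_left hst hx).trans_le hxt
  have hpos : ∀ s : ℝ, 0 < s → s < t →
      0 < (u * (Complex.sinh (z * s) * Complex.sinh (w * s))).re := fun s hs hst => by
    obtain ⟨a, b, ha, hb, hz'⟩ := exists_pos_sinh_mul_ofReal_eq hs (lt_pi_div_two hst hzt)
    obtain ⟨c, d, hc, hd, hw'⟩ := exists_pos_sinh_mul_ofReal_eq hs (lt_pi_div_two hst hwt)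
    rw [hz', hw']
    exact hu a b c d ha hb hc hd
  refine ⟨u, fun s hs hst => ?_⟩
  rcases hs.lt_or_gt with hs | hs
  · simpa [Complex.sinh_neg] using hpos (-s) (neg_pos.2 hs) (by rwa [abs_of_neg hs] at hst)
  · exact hpos s hs (by rwa [abs_of_pos hs] at hst)

/-! ### Spherical means of horospherical waves -/

theorem hasDerivAt_intervalIntegral_of_continuous {E : Type*} [NormedAddCommGroup E]
    [NormedSpace ℝ E] {F F' : ℝ → ℝ → E} (hF : Continuous (Function.uncurry F))
    (hF' : Continuous (Function.uncurry F')) (h : ∀ t x, HasDerivAt (fun t => F t x) (F' t x) t)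
    (a b t : ℝ) : HasDerivAt (fun t => ∫ x in a..b, F t x) (∫ x in a..b, F' t x) t := by
  obtain ⟨C, hC⟩ := ((isCompact_Icc (a := t - 1) (b := t + 1)).prod
    (isCompact_uIcc (a := a) (b := b))).exists_bound_of_continuousOn hF'.continuousOn
  refine (intervalIntegral.hasDerivAt_integral_of_dominated_loc_of_deriv_le (F := F) (F' := F')
    (s := Set.Icc (t - 1) (t + 1)) (bound := fun _ => C)
    (Icc_mem_nhds (by linarith) (by linarith)) ?_ ?_ ?_ ?_ intervalIntegrable_const ?_).2
  · exact .of_forall fun s => (hF.comp (Continuous.prodMk_right s)).aestronglyMeasurable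
  · exact (hF.comp (Continuous.prodMk_right t)).intervalIntegrable _ _
  · exact (hF'.comp (Continuous.prodMk_right t)).aestronglyMeasurable
  · exact .of_forall fun x hx s hs => hC (s, x) ⟨hs, Set.uIoc_subset_uIcc hx⟩
  · exact .of_forall fun x _ s _ => h s x

/-- The Busemann function of hyperbolic space of curvature `-1`, at distance `t` from the origin
and at angle `θ` to the geodesic ray along which it grows like `t`. Its level sets are the
horospheres at the opposite boundary point. -/
noncomputable def busemann (t θ : ℝ) : ℝ := Real.log (Real.cosh t + Real.sinh t * Real.cos θ)

/-- The radial derivative of `busemann`. -/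
noncomputable def busemannSlope (t θ : ℝ) : ℝ :=
  (Real.sinh t + Real.cosh t * Real.cos θ) / (Real.cosh t + Real.sinh t * Real.cos θ)

/-- The horospherical wave `exp (-α B)`, with `B` the Busemann function: it is the power `α` of the
Poisson kernel. -/
noncomputable def horowave (α : ℂ) (t θ : ℝ) : ℂ := Complex.exp (-α * busemann t θ)

theorem abs_sinh_lt_cosh (t : ℝ) : |Real.sinh t| < Real.cosh t :=
  abs_lt.2 ⟨by linarith [Real.cosh_add_sinh t, Real.exp_pos t], Real.sinh_lt_cosh t⟩

theorem cosh_add_sinh_mul_cos_pos (t θ : ℝ) : 0 < Real.cosh t + Real.sinh t * Real.cos θ := by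
  have h : |Real.sinh t * Real.cos θ| ≤ |Real.sinh t| := by
    rw [abs_mul]
    exact mul_le_of_le_one_right (abs_nonneg _) (Real.abs_cos_le_one θ)
  linarith [neg_le_of_abs_le h, abs_sinh_lt_cosh t]

theorem exp_neg_busemann (t θ : ℝ) :
    Real.exp (-busemann t θ) = (Real.cosh t + Real.sinh t * Real.cos θ)⁻¹ := by
  rw [Real.exp_neg, busemann, Real.exp_log (cosh_add_sinh_mul_cos_pos t θ)]

theorem busemann_zero (θ : ℝ) : busemann 0 θ = 0 := by simp [busemann]

theorem abs_busemann_lt {t θ : ℝ} (ht : 0 < t) (hθ : θ ∈ Set.Ioo 0 Real.pi) :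
    |busemann t θ| < t := by
  have hcos : |Real.cos θ| < 1 := by
    rw [← sq_lt_one_iff_abs_lt_one, ← sub_pos, ← Real.sin_sq]
    exact pow_pos (Real.sin_pos_of_mem_Ioo hθ) 2
  have hpos := cosh_add_sinh_mul_cos_pos t θ
  obtain ⟨hlower, hupper⟩ := abs_lt.1 hcos
  have hsinh := Real.sinh_pos_iff.2 ht
  refine abs_lt.2 ⟨(Real.lt_log_iff_exp_lt hpos).2 ?_, (Real.log_lt_iff_lt_exp hpos).2 ?_⟩
  · rw [← Real.cosh_sub_sinh]
    nlinarith
  · rw [← Real.cosh_add_sinh]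
    nlinarith

theorem busemann_pi_div_two_ne_zero {t : ℝ} (ht : t ≠ 0) : busemann t (Real.pi / 2) ≠ 0 := by
  simpa [busemann] using (Real.log_pos (Real.one_lt_cosh.2 ht)).ne'

@[fun_prop]
theorem continuous_busemann {X : Type*} [TopologicalSpace X] {f g : X → ℝ} (hf : Continuous f)
    (hg : Continuous g) : Continuous fun x => busemann (f x) (g x) :=
  Continuous.log (by fun_prop) fun x => (cosh_add_sinh_mul_cos_pos (f x) (g x)).ne'

@[fun_prop]
theorem continuous_busemannSlope {X : Type*} [TopologicalSpace X] {f g : X → ℝ}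
    (hf : Continuous f) (hg : Continuous g) : Continuous fun x => busemannSlope (f x) (g x) :=
  Continuous.div (by fun_prop) (by fun_prop) fun x => (cosh_add_sinh_mul_cos_pos (f x) (g x)).ne'

@[fun_prop]
theorem continuous_horowave (α : ℂ) {X : Type*} [TopologicalSpace X] {f g : X → ℝ}
    (hf : Continuous f) (hg : Continuous g) : Continuous fun x => horowave α (f x) (g x) := by
  unfold horowave
  fun_prop

theorem hasDerivAt_busemann (t θ : ℝ) :
    HasDerivAt (fun t => busemann t θ) (busemannSlope t θ) t :=
  ((Real.hasDerivAt_cosh t).add ((Real.hasDerivAt_sinh t).mul_const _)).log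
    (cosh_add_sinh_mul_cos_pos t θ).ne'

theorem hasDerivAt_busemannSlope (t θ : ℝ) :
    HasDerivAt (fun t => busemannSlope t θ) (1 - busemannSlope t θ ^ 2) t := by
  have hpos := (cosh_add_sinh_mul_cos_pos t θ).ne'
  refine (((Real.hasDerivAt_sinh t).add ((Real.hasDerivAt_cosh t).mul_const (Real.cos θ))).div
    ((Real.hasDerivAt_cosh t).add ((Real.hasDerivAt_sinh t).mul_const (Real.cos θ)))
    hpos).congr_deriv ?_
  simp only [Pi.add_apply, busemannSlope]
  field_simp

theorem hasDerivAt_busemann_angle (t θ : ℝ) :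
    HasDerivAt (fun θ => busemann t θ)
      (-(Real.sinh t * Real.sin θ * Real.exp (-busemann t θ))) θ := by
  have h := (((Real.hasDerivAt_cos θ).const_mul (Real.sinh t)).const_add (Real.cosh t)).log
    (cosh_add_sinh_mul_cos_pos t θ).ne'
  refine h.congr_deriv ?_
  rw [exp_neg_busemann]
  ring

/-- The eikonal equation `|∇B| = 1`. -/
theorem one_sub_busemannSlope_sq (t θ : ℝ) :
    1 - busemannSlope t θ ^ 2 = (Real.sin θ * Real.exp (-busemann t θ)) ^ 2 := by
  have hpos := (cosh_add_sinh_mul_cos_pos t θ).ne'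
  rw [exp_neg_busemann, busemannSlope]
  field_simp
  rw [Real.sin_sq]
  linear_combination (1 - Real.cos θ ^ 2) * Real.cosh_sq t

theorem cosh_mul_busemannSlope_sub_sinh (t θ : ℝ) :
    Real.cosh t * busemannSlope t θ - Real.sinh t = Real.cos θ * Real.exp (-busemann t θ) := by
  have hpos := (cosh_add_sinh_mul_cos_pos t θ).ne'
  rw [exp_neg_busemann, busemannSlope]
  field_simp
  linear_combination Real.cos θ * Real.cosh_sq t

theorem horowave_zero (α : ℂ) (θ : ℝ) : horowave α 0 θ = 1 := by simp [horowave, busemann_zero]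

theorem horowave_add_one (α : ℂ) (t θ : ℝ) :
    horowave (α + 1) t θ = (Real.exp (-busemann t θ) : ℝ) * horowave α t θ := by
  rw [horowave, horowave, Complex.ofReal_exp, ← Complex.exp_add]
  push_cast
  ring_nf

theorem hasDerivAt_horowave (α : ℂ) (t θ : ℝ) :
    HasDerivAt (fun t => horowave α t θ) (-α * busemannSlope t θ * horowave α t θ) t :=
  ((hasDerivAt_busemann t θ).ofReal_comp.const_mul (-α)).cexp.congr_deriv (mul_comm _ _)

theorem hasDerivAt_deriv_horowave (α : ℂ) (t θ : ℝ) :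
    HasDerivAt (fun t => -α * busemannSlope t θ * horowave α t θ)
      ((α ^ 2 * (busemannSlope t θ : ℂ) ^ 2 - α * (1 - (busemannSlope t θ : ℂ) ^ 2)) *
        horowave α t θ) t := by
  refine (((hasDerivAt_busemannSlope t θ).ofReal_comp.const_mul (-α)).mul
    (hasDerivAt_horowave α t θ)).congr_deriv ?_
  push_cast
  ring

theorem hasDerivAt_horowave_angle (α : ℂ) (t θ : ℝ) :
    HasDerivAt (fun θ => horowave α t θ)
      (α * (Real.sinh t * Real.sin θ) * horowave (α + 1) t θ) θ := by
  refine ((hasDerivAt_busemann_angle t θ).ofReal_comp.const_mul (-α)).cexp.congr_deriv ?_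
  rw [horowave_add_one, horowave]
  push_cast
  ring

/-- `sin θ ^ n` times the spherical part of the Laplacian of `horowave α`, up to the factor
`-α / sinh t`. -/
noncomputable def angularDivergence (n : ℕ) (α : ℂ) (t θ : ℝ) : ℂ :=
  ((n + 1) * Real.cos θ * horowave (α + 1) t θ +
    (α + 1) * (Real.sinh t * Real.sin θ ^ 2) * horowave (α + 1 + 1) t θ) * Real.sin θ ^ n

theorem hasDerivAt_sin_pow_mul_horowave (n : ℕ) (α : ℂ) (t θ : ℝ) :
    HasDerivAt (fun θ => (Real.sin θ : ℂ) ^ (n + 1) * horowave (α + 1) t θ)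
      (angularDivergence n α t θ) θ := by
  refine (((Real.hasDerivAt_sin θ).ofReal_comp.fun_pow (n + 1)).mul
    (hasDerivAt_horowave_angle (α + 1) t θ)).congr_deriv ?_
  rw [angularDivergence]
  push_cast [Nat.add_sub_cancel]
  ring

theorem integral_angularDivergence (n : ℕ) (α : ℂ) (t : ℝ) :
    ∫ θ in (0 : ℝ)..Real.pi, angularDivergence n α t θ = 0 := by
  rw [intervalIntegral.integral_eq_sub_of_hasDerivAt
    (fun θ _ => hasDerivAt_sin_pow_mul_horowave n α t θ)
    (Continuous.intervalIntegrable (by unfold angularDivergence; fun_prop) _ _)]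
  simp

theorem horowave_eigen (n : ℕ) (α : ℂ) {t : ℝ} (ht : 0 < t) (θ : ℝ) :
    ((α ^ 2 * (busemannSlope t θ : ℂ) ^ 2 - α * (1 - (busemannSlope t θ : ℂ) ^ 2)) *
        horowave α t θ +
      (n + 1) * (Real.cosh t / Real.sinh t) * (-α * busemannSlope t θ * horowave α t θ) +
      (α * (n + 1) - α ^ 2) * horowave α t θ) * Real.sin θ ^ n =
    -(α / Real.sinh t) * angularDivergence n α t θ := by
  have hsinh : (Real.sinh t : ℂ) ≠ 0 := by exact_mod_cast (Real.sinh_pos_iff.2 ht).ne'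
  have eikonal : 1 - (busemannSlope t θ : ℂ) ^ 2 =
    ((Real.sin θ : ℂ) * (Real.exp (-busemann t θ) : ℝ)) ^ 2 := by
    exact_mod_cast one_sub_busemannSlope_sq t θ
  have hcosh : (Real.cosh t : ℂ) * busemannSlope t θ - Real.sinh t =
      Real.cos θ * (Real.exp (-busemann t θ) : ℝ) := by
    exact_mod_cast cosh_mul_busemannSlope_sub_sinh t θ
  rw [angularDivergence, horowave_add_one (α + 1), horowave_add_one α]
  generalize horowave α t θ = W
  field_simp
  linear_combination
    (-α * (α + 1) * Real.sinh t * eikonal - α * (n + 1) * hcosh) * W * Real.sin θ ^ n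

/-- The mean of `horowave α` over the `(n + 1)`-sphere of radius `t`, not normalised:
`sin θ ^ n` is the density of the angle `θ`. -/
noncomputable def sphericalMean (n : ℕ) (α : ℂ) (t : ℝ) : ℂ :=
  ∫ θ in (0 : ℝ)..Real.pi, horowave α t θ * Real.sin θ ^ n

theorem hasDerivAt_sphericalMean (n : ℕ) (α : ℂ) (t : ℝ) :
    HasDerivAt (sphericalMean n α) (∫ θ in (0 : ℝ)..Real.pi,
      -α * busemannSlope t θ * horowave α t θ * Real.sin θ ^ n) t :=
  hasDerivAt_intervalIntegral_of_continuous
    (F' := fun t θ => -α * busemannSlope t θ * horowave α t θ * Real.sin θ ^ n)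
    (by unfold Function.uncurry; fun_prop) (by unfold Function.uncurry; fun_prop)
    (fun t θ => (hasDerivAt_horowave α t θ).mul_const _) _ _ t

theorem hasDerivAt_deriv_sphericalMean (n : ℕ) (α : ℂ) (t : ℝ) :
    HasDerivAt (fun t => ∫ θ in (0 : ℝ)..Real.pi,
        -α * busemannSlope t θ * horowave α t θ * Real.sin θ ^ n)
      (∫ θ in (0 : ℝ)..Real.pi,
        (α ^ 2 * (busemannSlope t θ : ℂ) ^ 2 - α * (1 - (busemannSlope t θ : ℂ) ^ 2)) *
          horowave α t θ * Real.sin θ ^ n) t :=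
  hasDerivAt_intervalIntegral_of_continuous
    (F := fun t θ => -α * busemannSlope t θ * horowave α t θ * Real.sin θ ^ n)
    (F' := fun t θ => (α ^ 2 * (busemannSlope t θ : ℂ) ^ 2 -
      α * (1 - (busemannSlope t θ : ℂ) ^ 2)) * horowave α t θ * Real.sin θ ^ n)
    (by unfold Function.uncurry; fun_prop) (by unfold Function.uncurry; fun_prop)
    (fun t θ => (hasDerivAt_deriv_horowave α t θ).mul_const _) _ _ t

theorem isPolarEigenfunction_sphericalMean (n : ℕ) (α : ℂ) :
    IsPolarEigenfunction (n + 1) 1 (α * (n + 1 : ℕ) - α ^ 2) (sphericalMean n α) := by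
  refine .of_hasDerivAt (hasDerivAt_sphericalMean n α 0).continuousAt.continuousWithinAt
    (fun t _ => hasDerivAt_sphericalMean n α t)
    (fun t _ => hasDerivAt_deriv_sphericalMean n α t) fun t ht => ?_
  rw [sphericalMean, ← intervalIntegral.integral_const_mul, ← intervalIntegral.integral_const_mul,
    ← intervalIntegral.integral_add, ← intervalIntegral.integral_add]
  · calc _ = ∫ θ in (0 : ℝ)..Real.pi, -(α / Real.sinh t) * angularDivergence n α t θ := by
          refine intervalIntegral.integral_congr fun θ _ => ?_
          simp only [← horowave_eigen n α ht θ, div_one]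
          push_cast
          ring
      _ = 0 := by
          rw [intervalIntegral.integral_const_mul, integral_angularDivergence, mul_zero]
  all_goals exact Continuous.intervalIntegrable (by fun_prop) _ _

theorem sphericalMean_zero (n : ℕ) (α : ℂ) :
    sphericalMean n α 0 = ((∫ θ in (0 : ℝ)..Real.pi, Real.sin θ ^ n : ℝ) : ℂ) := by
  simp only [sphericalMean, horowave_zero, one_mul, ← Complex.ofReal_pow]
  exact intervalIntegral.integral_ofReal

theorem sphericalMean_sub (n : ℕ) (α : ℂ) {t : ℝ} (ht : 0 ≤ t) :
    sphericalMean n ((n + 1 : ℕ) - α) t = sphericalMean n α t := by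
  have hα := isPolarEigenfunction_sphericalMean n α
  have hα' := isPolarEigenfunction_sphericalMean n ((n + 1 : ℕ) - α)
  rw [show ((n + 1 : ℕ) - α) * (n + 1 : ℕ) - ((n + 1 : ℕ) - α) ^ 2 = α * (n + 1 : ℕ) - α ^ 2 by
    ring] at hα'
  have h := hα.mul_eq_mul hα' n.succ_ne_zero one_pos ht
  rw [sphericalMean_zero, sphericalMean_zero] at h
  exact (mul_left_cancel₀ (by exact_mod_cast (integral_sin_pow_pos n).ne') h).symm

theorem cosh_sub_cosh (x y : ℂ) : Complex.cosh x - Complex.cosh y =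
    2 * (Complex.sinh ((x + y) / 2) * Complex.sinh ((x - y) / 2)) := by
  have hx := Complex.cosh_add ((x + y) / 2) ((x - y) / 2)
  have hy := Complex.cosh_sub ((x + y) / 2) ((x - y) / 2)
  ring_nf at hx hy ⊢
  rw [hx, hy]
  ring

theorem horowave_add_horowave_sub (κ α : ℂ) (t θ : ℝ) :
    horowave α t θ + horowave (κ - α) t θ =
      2 * (horowave (κ / 2) t θ * Complex.cosh ((α - κ / 2) * busemann t θ)) := by
  simp only [horowave]
  rw [mul_left_comm, Complex.two_cosh, mul_add, ← Complex.exp_add, ← Complex.exp_add, add_comm]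
  ring_nf

theorem sphericalMean_eq_integral_cosh (n : ℕ) (α : ℂ) {t : ℝ} (ht : 0 ≤ t) :
    sphericalMean n α t = ∫ θ in (0 : ℝ)..Real.pi,
      horowave ((n + 1 : ℕ) / 2) t θ *
        Complex.cosh ((α - (n + 1 : ℕ) / 2) * busemann t θ) * Real.sin θ ^ n := by
  have hmean : sphericalMean n α t + sphericalMean n ((n + 1 : ℕ) - α) t =
      ∫ θ in (0 : ℝ)..Real.pi, 2 * (horowave ((n + 1 : ℕ) / 2) t θ *
        Complex.cosh ((α - (n + 1 : ℕ) / 2) * busemann t θ) * Real.sin θ ^ n) := by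
    rw [sphericalMean, sphericalMean, ← intervalIntegral.integral_add
      (Continuous.intervalIntegrable (by fun_prop) _ _)
      (Continuous.intervalIntegrable (by fun_prop) _ _)]
    simp only [← add_mul, horowave_add_horowave_sub, mul_assoc]
  rw [sphericalMean_sub n α ht, intervalIntegral.integral_const_mul, ← two_mul] at hmean
  exact mul_left_cancel₀ two_ne_zero hmean

theorem sphericalMean_sub_sphericalMean (n : ℕ) (α β : ℂ) {t : ℝ} (ht : 0 ≤ t) :
    sphericalMean n α t - sphericalMean n β t = ∫ θ in (0 : ℝ)..Real.pi,
      ((2 * Real.exp (-((n + 1 : ℕ) / 2 * busemann t θ)) * Real.sin θ ^ n : ℝ) : ℂ) *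
        (Complex.sinh ((α + β - (n + 1 : ℕ)) / 2 * busemann t θ) *
          Complex.sinh ((α - β) / 2 * busemann t θ)) := by
  rw [sphericalMean_eq_integral_cosh n α ht, sphericalMean_eq_integral_cosh n β ht,
    ← intervalIntegral.integral_sub]
  · refine intervalIntegral.integral_congr fun θ _ => ?_
    simp only [← sub_mul, ← mul_sub, cosh_sub_cosh, horowave]
    push_cast
    ring_nf
  all_goals exact Continuous.intervalIntegrable (by fun_prop) _ _

theorem intervalIntegral_ne_zero_of_re_mul_nonneg {f : ℝ → ℂ} {a b : ℝ} {u : ℂ} (hab : a < b)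
    (hf : Continuous f) (hnonneg : ∀ x ∈ Set.Ioo a b, 0 ≤ (u * f x).re)
    (hpos : ∃ x ∈ Set.Ioo a b, 0 < (u * f x).re) : ∫ x in a..b, f x ≠ 0 := by
  have hcont : Continuous fun x => (u * f x).re := by fun_prop
  have hclosure : ∀ x ∈ Set.Ioc a b, 0 ≤ (u * f x).re := fun x hx =>
    le_on_closure hnonneg continuousOn_const hcont.continuousOn
      (by rw [closure_Ioo hab.ne]; exact Set.Ioc_subset_Icc_self hx)
  obtain ⟨x, hx, hxpos⟩ := hpos
  have hint : 0 < ∫ x in a..b, (u * f x).re := intervalIntegral.integral_pos hab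
    hcont.continuousOn hclosure ⟨x, Set.Ioo_subset_Icc_self hx, hxpos⟩
  intro hzero
  have hint_mul : IntervalIntegrable (fun x => u * f x) MeasureTheory.volume a b :=
    Continuous.intervalIntegrable (by fun_prop) _ _
  have hre := Complex.reCLM.intervalIntegral_comp_comm hint_mul
  rw [intervalIntegral.integral_const_mul u, hzero, mul_zero, map_zero] at hre
  exact hint.ne' hre

theorem sphericalMean_ne (n : ℕ) {α β : ℂ} (hsub : α ≠ β) (hadd : α + β ≠ (n + 1 : ℕ)) {t : ℝ}
    (ht : 0 < t) (hle : (|α.im| + |β.im|) * t ≤ Real.pi) :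
    sphericalMean n α t ≠ sphericalMean n β t := by
  set z := (α + β - (n + 1 : ℕ)) / 2
  set w := (α - β) / 2
  have hz : |z.im| * t ≤ Real.pi / 2 := by
    have him : z.im = (α.im + β.im) / 2 := by simp [z]
    rw [him, abs_div, abs_two]
    nlinarith [abs_add_le α.im β.im]
  have hw : |w.im| * t ≤ Real.pi / 2 := by
    have him : w.im = (α.im - β.im) / 2 := by simp [w]
    rw [him, abs_div, abs_two]
    nlinarith [abs_sub α.im β.im]
  obtain ⟨u, hu⟩ := exists_forall_re_mul_sinh_mul_sinh_pos (z := z) (w := w)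
    (div_ne_zero (sub_ne_zero.2 hadd) two_ne_zero) (div_ne_zero (sub_ne_zero.2 hsub) two_ne_zero)
    hz hw
  rw [← sub_ne_zero, sphericalMean_sub_sphericalMean n α β ht.le]
  have hre (a : ℝ) (ζ : ℂ) : (u * ((a : ℂ) * ζ)).re = a * (u * ζ).re := by
    rw [mul_left_comm, Complex.re_ofReal_mul]
  have hmid : Real.pi / 2 ∈ Set.Ioo 0 Real.pi := ⟨by positivity, by linarith [Real.pi_pos]⟩
  refine intervalIntegral_ne_zero_of_re_mul_nonneg (u := u) Real.pi_pos (by fun_prop)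
    (fun θ hθ => ?_) ⟨Real.pi / 2, hmid, ?_⟩
  · rw [hre]
    have hsin := Real.sin_pos_of_mem_Ioo hθ
    rcases eq_or_ne (busemann t θ) 0 with hB | hB
    · simp [hB]
    · have hB_pos := hu _ hB (abs_busemann_lt ht hθ)
      positivity
  · rw [hre]
    have hsin := Real.sin_pos_of_mem_Ioo hmid
    have hB_pos := hu _ (busemann_pi_div_two_ne_zero ht.ne') (abs_busemann_lt ht hmid)
    positivity

/-! ### Radial functions on the ball -/

theorem hasFDerivAt_norm_of_ne_zero {E : Type*} [NormedAddCommGroup E] [InnerProductSpace ℝ E]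
    {x : E} (hx : x ≠ 0) : HasFDerivAt (fun y : E => ‖y‖) (‖x‖⁻¹ • innerSL ℝ x) x := by
  have h := (hasStrictFDerivAt_norm_sq x).hasFDerivAt.sqrt (by simpa using hx)
  simp only [Real.sqrt_sq (norm_nonneg _)] at h
  refine h.congr_fderiv ?_
  ext v
  simp only [smul_apply, smul_eq_mul, innerSL_apply_apply]
  ring

section RadialField

variable {k : ℕ} {g : ℝ → ℂ} {g' : ℂ} {x : EuclideanSpace ℝ (Fin (k + 1))}

theorem hasFDerivAt_comp_norm (hx : x ≠ 0) (hg : HasDerivAt g g' ‖x‖) :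
    HasFDerivAt (fun y : EuclideanSpace ℝ (Fin (k + 1)) => g ‖y‖)
      ((ContinuousLinearMap.toSpanSingleton ℝ g').comp (‖x‖⁻¹ • innerSL ℝ x)) x :=
  hg.hasFDerivAt.comp x (hasFDerivAt_norm_of_ne_zero hx)

theorem partialDeriv_comp_norm (hx : x ≠ 0) (hg : HasDerivAt g g' ‖x‖) (i : Fin (k + 1)) :
    partialDeriv i (fun y => g ‖y‖) x = ((x i / ‖x‖ : ℝ) : ℂ) * g' := by
  rw [partialDeriv, (hasFDerivAt_comp_norm hx hg).fderiv]
  simp [EuclideanSpace.inner_single_right, div_eq_inv_mul, mul_assoc]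

theorem partialDeriv_coord_mul_comp_norm (hx : x ≠ 0) (hg : HasDerivAt g g' ‖x‖)
    (i : Fin (k + 1)) :
    partialDeriv i (fun y => ((y i : ℝ) : ℂ) * g ‖y‖) x =
      ((x i ^ 2 : ℝ) : ℂ) * (g' / ‖x‖) + g ‖x‖ := by
  have hcoord : HasFDerivAt (fun y : EuclideanSpace ℝ (Fin (k + 1)) => ((y i : ℝ) : ℂ))
      (Complex.ofRealCLM.comp (EuclideanSpace.proj i)) x :=
    (Complex.ofRealCLM.comp (EuclideanSpace.proj i)).hasFDerivAt
  rw [partialDeriv, (hcoord.fun_mul (hasFDerivAt_comp_norm hx hg)).fderiv]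
  have hx' : (‖x‖ : ℂ) ≠ 0 := by simpa using hx
  simp [EuclideanSpace.inner_single_right]
  field_simp

theorem sum_partialDeriv_coord_mul_comp_norm (hx : x ≠ 0) (hg : HasDerivAt g g' ‖x‖) :
    ∑ i, partialDeriv i (fun y => ((y i : ℝ) : ℂ) * g ‖y‖) x = ‖x‖ * g' + (k + 1) * g ‖x‖ := by
  have hx' : (‖x‖ : ℂ) ≠ 0 := by simpa using hx
  simp only [partialDeriv_coord_mul_comp_norm hx hg]
  rw [Finset.sum_add_distrib, ← Finset.sum_mul, ← Complex.ofReal_sum,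
    ← EuclideanSpace.real_norm_sq_eq, Finset.sum_const, Finset.card_fin, nsmul_eq_mul]
  push_cast
  field_simp [hx']

end RadialField

/-- `hyperbolicRadius` as a function of the Euclidean norm. -/
noncomputable def radialDistance (ρ t : ℝ) : ℝ := ρ * Real.log ((ρ + t) / (ρ - t))

/-- `conformalFactor` as a function of the Euclidean norm. -/
noncomputable def radialFactor (ρ t : ℝ) : ℝ := 2 * ρ ^ 2 / (ρ ^ 2 - t ^ 2)

/-- The Laplacian on the ball is the divergence of the weighted gradient; for `φ` of the hyperbolic
radius that gradient is `radialFlux k ρ φ ‖x‖ • x`. -/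
noncomputable def radialFlux (k : ℕ) (ρ : ℝ) (φ : ℝ → ℂ) (t : ℝ) : ℂ :=
  ((radialFactor ρ t ^ k / t : ℝ) : ℂ) * deriv φ (radialDistance ρ t)

theorem radialDistance_mul_tanh {ρ : ℝ} (hρ : ρ ≠ 0) (s : ℝ) :
    radialDistance ρ (ρ * Real.tanh s) = 2 * ρ * s := by
  have hs := Real.artanh_eq_half_log (x := Real.tanh s)
    (Set.Ioo_subset_Icc_self (abs_lt.1 (Real.abs_tanh_lt_one s)))
  rw [Real.artanh_tanh] at hs
  rw [radialDistance, ← mul_one_add, ← mul_one_sub, mul_div_mul_left _ _ hρ]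
  linear_combination -2 * ρ * hs

theorem contDiff_tanh {n : WithTop ℕ∞} : ContDiff ℝ n Real.tanh := by
  rw [funext Real.tanh_eq_sinh_div_cosh]
  exact Real.contDiff_sinh.div Real.contDiff_cosh fun x => (Real.cosh_pos x).ne'

section BallModel

variable {k : ℕ} {ρ t : ℝ} {φ : ℝ → ℂ}

theorem sq_sub_sq_pos_of_mem_Ioo (ht : t ∈ Set.Ioo 0 ρ) : 0 < ρ ^ 2 - t ^ 2 := by
  nlinarith [ht.1, ht.2]

theorem radialFactor_pos (ht : t ∈ Set.Ioo 0 ρ) : 0 < radialFactor ρ t := by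
  have hρ := ht.1.trans ht.2
  have hsq := sq_sub_sq_pos_of_mem_Ioo ht
  unfold radialFactor
  positivity

theorem hasDerivAt_radialDistance (ht : t ∈ Set.Ioo 0 ρ) :
    HasDerivAt (radialDistance ρ) (radialFactor ρ t) t := by
  have hsub : ρ - t ≠ 0 := (sub_pos.2 ht.2).ne'
  have hadd : ρ + t ≠ 0 := (by linarith [ht.1, ht.2] : 0 < ρ + t).ne'
  have hsq := (sq_sub_sq_pos_of_mem_Ioo ht).ne'
  refine (((((hasDerivAt_id t).const_add ρ).fun_div ((hasDerivAt_id t).const_sub ρ) hsub).log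
    (div_ne_zero hadd hsub)).const_mul ρ).congr_deriv ?_
  simp only [id, radialFactor]
  field_simp
  ring

theorem hasDerivAt_radialFactor (ht : t ∈ Set.Ioo 0 ρ) :
    HasDerivAt (radialFactor ρ) (radialFactor ρ t ^ 2 * t / ρ ^ 2) t := by
  have hρ : ρ ≠ 0 := (ht.1.trans ht.2).ne'
  have hsq := (sq_sub_sq_pos_of_mem_Ioo ht).ne'
  refine ((hasDerivAt_const t (2 * ρ ^ 2)).fun_div (((hasDerivAt_id t).fun_pow 2).const_sub
    (ρ ^ 2)) hsq).congr_deriv ?_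
  simp only [id, radialFactor]
  field_simp [hρ]
  ring

theorem hasDerivAt_radialFlux (ht : t ∈ Set.Ioo 0 ρ)
    (hφ : DifferentiableAt ℝ (deriv φ) (radialDistance ρ t)) :
    HasDerivAt (radialFlux k ρ φ)
      (((k * radialFactor ρ t ^ (k + 1) / ρ ^ 2 - radialFactor ρ t ^ k / t ^ 2 : ℝ) : ℂ) *
          deriv φ (radialDistance ρ t) +
        ((radialFactor ρ t ^ (k + 1) / t : ℝ) : ℂ) * deriv (deriv φ) (radialDistance ρ t)) t := by
  have hρ : ρ ≠ 0 := (ht.1.trans ht.2).ne'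
  have ht' : t ≠ 0 := ht.1.ne'
  have hweight : HasDerivAt (fun t => radialFactor ρ t ^ k / t)
      (k * radialFactor ρ t ^ (k + 1) / ρ ^ 2 - radialFactor ρ t ^ k / t ^ 2) t := by
    refine (((hasDerivAt_radialFactor ht).fun_pow k).fun_div (hasDerivAt_id t) ht').congr_deriv ?_
    rcases k with _ | n
    · simp [neg_div]
    · simp only [id, Nat.add_sub_cancel]
      field_simp
      ring
  refine (hweight.ofReal_comp.mul
    (hφ.hasDerivAt.scomp t (hasDerivAt_radialDistance ht))).congr_deriv ?_
  simp only [Function.comp_apply, Complex.real_smul]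
  push_cast
  ring

theorem one_div_mul_coth_radialDistance (ht : t ∈ Set.Ioo 0 ρ) :
    1 / ρ * (Real.cosh (radialDistance ρ t / ρ) / Real.sinh (radialDistance ρ t / ρ)) =
      t / ρ ^ 2 + (t * radialFactor ρ t)⁻¹ := by
  obtain ⟨ht0, htρ⟩ := ht
  have hρ : 0 < ρ := ht0.trans htρ
  have hsub : 0 < ρ - t := sub_pos.2 htρ
  have hadd : 0 < ρ + t := add_pos hρ ht0
  have hsinh : (ρ + t) / (ρ - t) - ((ρ + t) / (ρ - t))⁻¹ = 4 * ρ * t / ((ρ + t) * (ρ - t)) := by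
    field_simp
    ring
  rw [radialDistance, mul_div_cancel_left₀ _ hρ.ne', Real.cosh_log (div_pos hadd hsub),
    Real.sinh_log (div_pos hadd hsub), hsinh, radialFactor]
  field_simp
  ring

theorem weight_mul_partialDeriv_comp_hyperbolicRadius {x : EuclideanSpace ℝ (Fin (k + 1))}
    (hx : ‖x‖ ∈ Set.Ioo 0 ρ) (hφ : DifferentiableAt ℝ φ (hyperbolicRadius ρ x))
    (i : Fin (k + 1)) :
    ((conformalFactor ρ x ^ (k + 1) * (conformalFactor ρ x ^ 2)⁻¹ : ℝ) : ℂ) *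
        partialDeriv i (fun y => φ (hyperbolicRadius ρ y)) x =
      ((x i : ℝ) : ℂ) * radialFlux k ρ φ ‖x‖ := by
  have hcomp : HasDerivAt (fun t => φ (radialDistance ρ t))
      (radialFactor ρ ‖x‖ • deriv φ (radialDistance ρ ‖x‖)) ‖x‖ :=
    hφ.hasDerivAt.scomp ‖x‖ (hasDerivAt_radialDistance hx)
  have hfactor : (radialFactor ρ ‖x‖ : ℂ) ≠ 0 := by exact_mod_cast (radialFactor_pos hx).ne'
  have hnorm : (‖x‖ : ℂ) ≠ 0 := by exact_mod_cast hx.1.ne'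
  change ((radialFactor ρ ‖x‖ ^ (k + 1) * (radialFactor ρ ‖x‖ ^ 2)⁻¹ : ℝ) : ℂ) *
    partialDeriv i (fun y => φ (radialDistance ρ ‖y‖)) x = _
  rw [partialDeriv_comp_norm (norm_pos_iff.1 hx.1) hcomp, radialFlux, Complex.real_smul]
  push_cast
  field_simp
  ring

theorem hyperbolicLaplacian_comp_hyperbolicRadius_eq_deriv_radialFlux
    {m : EuclideanSpace ℝ (Fin (k + 1))} (hm : ‖m‖ ∈ Set.Ioo 0 ρ)
    (hφ : ∀ᶠ s in 𝓝 (hyperbolicRadius ρ m), DifferentiableAt ℝ φ s)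
    (hφ' : DifferentiableAt ℝ (deriv φ) (hyperbolicRadius ρ m)) :
    hyperbolicLaplacian ρ (fun x => φ (hyperbolicRadius ρ x)) m =
      (((radialFactor ρ ‖m‖ ^ (k + 1))⁻¹ : ℝ) : ℂ) *
        (‖m‖ * deriv (radialFlux k ρ φ) ‖m‖ + (k + 1) * radialFlux k ρ φ ‖m‖) := by
  have hcont : ContinuousAt (fun x => hyperbolicRadius ρ x) m :=
    (hasDerivAt_radialDistance hm).continuousAt.comp continuous_norm.continuousAt
  have hflux (i : Fin (k + 1)) :
      (fun x => ((conformalFactor ρ x ^ (k + 1) * (conformalFactor ρ x ^ 2)⁻¹ : ℝ) : ℂ) *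
        partialDeriv i (fun y => φ (hyperbolicRadius ρ y)) x) =ᶠ[𝓝 m]
      fun x => ((x i : ℝ) : ℂ) * radialFlux k ρ φ ‖x‖ := by
    filter_upwards [continuous_norm.continuousAt.eventually (isOpen_Ioo.mem_nhds hm),
      hcont.eventually hφ] with x hx hφx
      using weight_mul_partialDeriv_comp_hyperbolicRadius hx hφx i
  rw [← sum_partialDeriv_coord_mul_comp_norm (norm_pos_iff.1 hm.1)
    (hasDerivAt_radialFlux hm hφ').differentiableAt.hasDerivAt]
  refine congrArg _ (Finset.sum_congr rfl fun i _ => ?_)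
  rw [partialDeriv, (hflux i).fderiv_eq, partialDeriv]

theorem hyperbolicLaplacian_comp_hyperbolicRadius {m : EuclideanSpace ℝ (Fin (k + 1))}
    (hm : ‖m‖ ∈ Set.Ioo 0 ρ) (hφ : ∀ᶠ s in 𝓝 (hyperbolicRadius ρ m), DifferentiableAt ℝ φ s)
    (hφ' : DifferentiableAt ℝ (deriv φ) (hyperbolicRadius ρ m)) :
    hyperbolicLaplacian ρ (fun x => φ (hyperbolicRadius ρ x)) m =
      polarLaplacian k ρ φ (hyperbolicRadius ρ m) := by
  rw [hyperbolicLaplacian_comp_hyperbolicRadius_eq_deriv_radialFlux hm hφ hφ',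
    (hasDerivAt_radialFlux hm hφ').deriv]
  change _ = polarLaplacian k ρ φ (radialDistance ρ ‖m‖)
  rw [polarLaplacian, div_eq_mul_one_div (k : ℝ), mul_assoc (k : ℝ),
    one_div_mul_coth_radialDistance hm, radialFlux]
  have hfactor : (radialFactor ρ ‖m‖ : ℂ) ≠ 0 := by exact_mod_cast (radialFactor_pos hm).ne'
  have hnorm : (‖m‖ : ℂ) ≠ 0 := by exact_mod_cast hm.1.ne'
  have hρ : (ρ : ℂ) ≠ 0 := by exact_mod_cast (hm.1.trans hm.2).ne'
  push_cast
  field_simp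
  ring

end BallModel

/-- The geodesic ray from the origin along the first coordinate axis, parametrised by hyperbolic
length. -/
noncomputable def geodesicRay (k : ℕ) (ρ r : ℝ) : EuclideanSpace ℝ (Fin (k + 1)) :=
  (ρ * Real.tanh (r / (2 * ρ))) • EuclideanSpace.single 0 1

section GeodesicRay

variable (k : ℕ) {ρ : ℝ}

theorem contDiff_geodesicRay (ρ : ℝ) {n : WithTop ℕ∞} : ContDiff ℝ n (geodesicRay k ρ) :=
  (contDiff_const.mul (contDiff_tanh.comp (contDiff_id.div_const _))).smul contDiff_const

theorem norm_geodesicRay (hρ : 0 < ρ) (r : ℝ) :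
    ‖geodesicRay k ρ r‖ = ρ * |Real.tanh (r / (2 * ρ))| := by
  simp [geodesicRay, norm_smul, abs_of_pos hρ]

theorem geodesicRay_mem_ball (hρ : 0 < ρ) (r : ℝ) : geodesicRay k ρ r ∈ Metric.ball 0 ρ := by
  rw [mem_ball_zero_iff, norm_geodesicRay k hρ]
  exact mul_lt_of_lt_one_right hρ (Real.abs_tanh_lt_one _)

theorem norm_geodesicRay_pos (hρ : 0 < ρ) {r : ℝ} (hr : 0 < r) : 0 < ‖geodesicRay k ρ r‖ := by
  have hsinh : 0 < Real.sinh (r / (2 * ρ)) := Real.sinh_pos_iff.2 (by positivity)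
  rw [norm_geodesicRay k hρ, Real.tanh_eq_sinh_div_cosh]
  exact mul_pos hρ (abs_pos.2 (div_pos hsinh (Real.cosh_pos _)).ne')

theorem hyperbolicRadius_geodesicRay (hρ : 0 < ρ) {r : ℝ} (hr : 0 ≤ r) :
    hyperbolicRadius ρ (geodesicRay k ρ r) = r := by
  have htanh : 0 ≤ Real.tanh (r / (2 * ρ)) := by
    rw [Real.tanh_eq_sinh_div_cosh]
    exact div_nonneg (Real.sinh_nonneg_iff.2 (by positivity)) (Real.cosh_pos _).le
  change radialDistance ρ ‖geodesicRay k ρ r‖ = r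
  rw [norm_geodesicRay k hρ, abs_of_nonneg htanh, radialDistance_mul_tanh hρ.ne']
  field_simp

end GeodesicRay

namespace IsRadialEigenfunction

variable {k : ℕ} {ρ : ℝ} {μ : ℂ} {φ : ℝ → ℂ}

theorem exists_contDiff_eqOn (h : IsRadialEigenfunction k ρ μ φ) (hρ : 0 < ρ) :
    ∃ F : ℝ → ℂ, ContDiff ℝ 2 F ∧ Set.EqOn φ F (Set.Ici 0) :=
  ⟨_, h.contDiffOn.comp_contDiff (contDiff_geodesicRay k ρ) (geodesicRay_mem_ball k hρ),
    fun _ hr => congrArg φ (hyperbolicRadius_geodesicRay k hρ hr).symm⟩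

theorem isPolarEigenfunction (h : IsRadialEigenfunction k ρ μ φ) (hρ : 0 < ρ) :
    IsPolarEigenfunction k ρ μ φ := by
  obtain ⟨F, hF, hφF⟩ := h.exists_contDiff_eqOn hρ
  have heq {r : ℝ} (hr : 0 < r) : φ =ᶠ[𝓝 r] F := hφF.eventuallyEq_of_mem (Ici_mem_nhds hr)
  have hφ {r : ℝ} (hr : 0 < r) : DifferentiableAt ℝ φ r :=
    (hF.differentiable two_ne_zero r).congr_of_eventuallyEq (heq hr)
  have hφ' {r : ℝ} (hr : 0 < r) : DifferentiableAt ℝ (deriv φ) r :=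
    (hF.differentiable_deriv_two r).congr_of_eventuallyEq (heq hr).deriv
  refine ⟨hF.continuous.continuousWithinAt.congr hφF (hφF Set.self_mem_Ici),
    fun r hr => (hφ hr).differentiableWithinAt, fun r hr => (hφ' hr).differentiableWithinAt,
    fun r hr => ?_⟩
  have hradius := hyperbolicRadius_geodesicRay k hρ (le_of_lt hr)
  have hmem := geodesicRay_mem_ball k hρ r
  have hnorm : ‖geodesicRay k ρ r‖ ∈ Set.Ioo 0 ρ :=
    ⟨norm_geodesicRay_pos k hρ hr, mem_ball_zero_iff.1 hmem⟩
  have hdiff : ∀ᶠ s in 𝓝 r, DifferentiableAt ℝ φ s :=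
    mem_of_superset (Ioi_mem_nhds hr) fun _ hs => hφ hs
  rw [← hradius, ← hyperbolicLaplacian_comp_hyperbolicRadius hnorm (by rwa [hradius])
    (by rw [hradius]; exact hφ' hr)]
  exact h.eigen _ hmem

end IsRadialEigenfunction

/-! ### Distinct eigenvalues -/

theorem IsPolarEigenfunction.sphericalMean_zero_mul {n : ℕ} {ρ : ℝ} (hρ : 0 < ρ) {μ α : ℂ}
    {φ : ℝ → ℂ} (h : IsPolarEigenfunction (n + 1) ρ μ φ)
    (hα : ρ ^ 2 * μ = α * (n + 1 : ℕ) - α ^ 2) {r : ℝ} (hr : 0 ≤ r) :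
    sphericalMean n α 0 * φ r = φ 0 * sphericalMean n α (r / ρ) := by
  have hφ := h.comp_mul_left hρ
  rw [div_self hρ.ne', hα] at hφ
  simpa [mul_div_cancel₀ r hρ.ne'] using hφ.mul_eq_mul (isPolarEigenfunction_sphericalMean n α)
    n.succ_ne_zero one_pos (div_nonneg hr hρ.le)

theorem IsPolarEigenfunction.ne_of_im_mul_le_pi_mul {k : ℕ} (hk : k ≠ 0) {ρ : ℝ} (hρ : 0 < ρ)
    {μ ν α β : ℂ} {φ ψ : ℝ → ℂ} (hφ : IsPolarEigenfunction k ρ μ φ)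
    (hψ : IsPolarEigenfunction k ρ ν ψ) (hzero : φ 0 = ψ 0) (hne : φ 0 ≠ 0) (hμν : μ ≠ ν)
    (hα : ρ ^ 2 * μ = α * k - α ^ 2) (hβ : ρ ^ 2 * ν = β * k - β ^ 2) {r : ℝ} (hr : 0 < r)
    (hle : (|α.im| + |β.im|) * r ≤ Real.pi * ρ) : φ r ≠ ψ r := by
  obtain ⟨n, rfl⟩ := Nat.exists_eq_add_one_of_ne_zero hk
  have hmul : (ρ : ℂ) ^ 2 * (μ - ν) = (α - β) * ((n + 1 : ℕ) - (α + β)) := by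
    rw [mul_sub, hα, hβ]
    ring
  have hspec := hmul ▸ mul_ne_zero (pow_ne_zero 2 (Complex.ofReal_ne_zero.2 hρ.ne'))
    (sub_ne_zero.2 hμν)
  have hmean_ne : sphericalMean n α (r / ρ) ≠ sphericalMean n β (r / ρ) :=
    sphericalMean_ne n (sub_ne_zero.1 (left_ne_zero_of_mul hspec))
      (sub_ne_zero.1 (right_ne_zero_of_mul hspec)).symm (div_pos hr hρ)
      (by rwa [← mul_div_assoc, div_le_iff₀ hρ])
  intro heq
  refine hmean_ne (mul_left_cancel₀ hne ?_)
  rw [← hφ.sphericalMean_zero_mul hρ hα hr.le, heq, hzero,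
    ← hψ.sphericalMean_zero_mul hρ hβ hr.le, sphericalMean_zero, sphericalMean_zero]

theorem eq_neg_curvature_mul_iff {ρ κ : ℝ} (hρ : ρ ≠ 0) (hκ : κ = -1 / ρ ^ 2) {μ s : ℂ} :
    μ = -κ * s ↔ ρ ^ 2 * μ = s := by
  have hρ' : (ρ : ℂ) ≠ 0 := Complex.ofReal_ne_zero.2 hρ
  rw [hκ]
  push_cast
  field_simp

theorem exists_real_spectral_parameter {ρ κ c : ℝ} (hρ : ρ ≠ 0) (hκ : κ = -1 / ρ ^ 2) {μ : ℂ}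
    (him : μ.im = 0) (hre : μ.re ≤ -κ * c ^ 2 / 4) :
    ∃ a : ℝ, μ = -κ * ((a : ℂ) * c - (a : ℂ) ^ 2) := by
  have hdisc : 0 ≤ c ^ 2 / 4 - ρ ^ 2 * μ.re := by
    have h := mul_le_mul_of_nonneg_left hre (sq_nonneg ρ)
    have hκ' : ρ ^ 2 * (-κ * c ^ 2 / 4) = c ^ 2 / 4 := by
      rw [hκ]
      field_simp
    linarith
  have hμ : μ = μ.re := Complex.ext rfl (by simpa using him)
  refine ⟨c / 2 + √(c ^ 2 / 4 - ρ ^ 2 * μ.re), (eq_neg_curvature_mul_iff hρ hκ).2 ?_⟩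
  rw [hμ]
  norm_cast
  linear_combination Real.sq_sqrt hdisc

theorem mem_oneRadiusInterval {ρ p r : ℝ} (hρ : 0 < ρ) (hp : 0 ≤ p) :
    r ∈ oneRadiusInterval ρ p ↔ 0 < r ∧ 2 * p * r ≤ Real.pi * ρ := by
  rw [oneRadiusInterval]
  split_ifs with hp0
  · have hπρ : 0 ≤ Real.pi * ρ := by positivity
    simp [hp0, hπρ]
  · rw [Set.mem_Ioc, le_div_iff₀' (by positivity)]

theorem add_mul_le_of_mem_oneRadiusInterval {ρ r x y : ℝ} (hρ : 0 < ρ)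
    (hr : r ∈ oneRadiusInterval ρ (max |x| |y|)) : 0 < r ∧ (|x| + |y|) * r ≤ Real.pi * ρ := by
  obtain ⟨hr, hle⟩ := (mem_oneRadiusInterval hρ (le_max_of_le_left (abs_nonneg x))).1 hr
  exact ⟨hr, by nlinarith [le_max_left |x| |y|, le_max_right |x| |y|]⟩

theorem mainTheorem2_general (k : ℕ) (hk : k ≠ 0) (ρ κ : ℝ) (hρ : 0 < ρ) (hκ : κ = -1 / ρ ^ 2)
    (μ ν : ℂ) (hμν : μ ≠ ν) (φ ψ : ℝ → ℂ)
    (hφ : IsRadialEigenfunction k ρ μ φ ∨ IsPolarEigenfunction k ρ μ φ)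
    (hψ : IsRadialEigenfunction k ρ ν ψ ∨ IsPolarEigenfunction k ρ ν ψ)
    (hzero : φ 0 = ψ 0) (hne : φ 0 ≠ 0) :
    (∀ α β : ℂ, μ = -κ * (α * k - α ^ 2) → ν = -κ * (β * k - β ^ 2) →
      ∀ r : ℝ, 0 < r → (|α.im| + |β.im|) * r ≤ Real.pi * ρ → φ r ≠ ψ r) ∧
    (μ.im = 0 → ν.im = 0 → μ.re ≤ -κ * k ^ 2 / 4 → ν.re ≤ -κ * k ^ 2 / 4 →
      ∀ r : ℝ, 0 < r → φ r ≠ ψ r) := by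
  replace hφ : IsPolarEigenfunction k ρ μ φ := hφ.elim (·.isPolarEigenfunction hρ) id
  replace hψ : IsPolarEigenfunction k ρ ν ψ := hψ.elim (·.isPolarEigenfunction hρ) id
  have hcurv {μ s : ℂ} := eq_neg_curvature_mul_iff hρ.ne' hκ (μ := μ) (s := s)
  have hdistinct (α β : ℂ) (hα : μ = -κ * (α * k - α ^ 2)) (hβ : ν = -κ * (β * k - β ^ 2)) (r : ℝ)
      (hr : 0 < r) (hle : (|α.im| + |β.im|) * r ≤ Real.pi * ρ) : φ r ≠ ψ r :=
    hφ.ne_of_im_mul_le_pi_mul hk hρ hψ hzero hne hμν (hcurv.1 hα) (hcurv.1 hβ) hr hle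
  refine ⟨hdistinct, fun hμ_im hν_im hμ_re hν_re r hr => ?_⟩
  obtain ⟨a, ha⟩ := exists_real_spectral_parameter hρ.ne' hκ hμ_im hμ_re
  obtain ⟨b, hb⟩ := exists_real_spectral_parameter hρ.ne' hκ hν_im hν_re
  exact hdistinct a b ha hb r hr (by
    simp only [Complex.ofReal_im, abs_zero, add_zero, zero_mul]
    positivity)

theorem mainTheorem2 (k : ℕ) (hk : 1 ≤ k) (ρ κ : ℝ) (hρ : 0 < ρ) (hκ : κ = -1 / ρ ^ 2)
    (μ ν : ℂ) (hμν : μ ≠ ν) (φ ψ : ℝ → ℂ)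
    -- both the intrinsic notion on the ball and the equation in polar coordinates are covered
    (h : (IsRadialEigenfunction k ρ μ φ ∧ IsRadialEigenfunction k ρ ν ψ) ∨
      (IsPolarEigenfunction k ρ μ φ ∧ IsPolarEigenfunction k ρ ν ψ))
    (hφ : φ 0 = 1) (hψ : ψ 0 = 1) :
    (∀ α β : ℂ, μ = -κ * (α * k - α ^ 2) → ν = -κ * (β * k - β ^ 2) →
      ∀ r ∈ oneRadiusInterval ρ (max |α.im| |β.im|), φ r ≠ ψ r) ∧
    (μ.im = 0 → ν.im = 0 → μ.re ≤ -κ * k ^ 2 / 4 → ν.re ≤ -κ * k ^ 2 / 4 →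
      ∀ r : ℝ, 0 < r → φ r ≠ ψ r) := by
  obtain ⟨hdistinct, hreal⟩ := mainTheorem2_general k (Nat.one_le_iff_ne_zero.1 hk) ρ κ hρ hκ μ ν
    hμν φ ψ (h.imp And.left And.left) (h.imp And.right And.right) (hφ.trans hψ.symm)
    (hφ ▸ one_ne_zero)
  refine ⟨fun α β hα hβ r hr => ?_, hreal⟩
  obtain ⟨hpos, hle⟩ := add_mul_le_of_mem_oneRadiusInterval hρ hr
  exact hdistinct α β hα hβ r hpos hle
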